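/- Let $k$ be an algebraically closed field and let $G$ be an affine algebraic group over $k$ (identified with its group of $k$-points). Let $A$ and $B$ be finitely generated commutative $k$-algebras on which $G$ acts rationally by $k$-algebra automorphisms, i.e. every element lies in a finite-dimensional $G$-stable subspace $V$ on which $G$ acts through a morphism of algebraic groups $G \to GL(V)$. Let $I \subseteq A$ and $J \subseteq B$ be $G$-invariant ideals, and let $d \colon A \to B$ be a $G$-equivariant $k$-algebra homomorphism such that for all $n$ one has $d(I^n) \subseteq J^n$ and the induced map $A/I^n \to B/J^n$ is an isomorphism. Then the set of all points of $\operatorname{Spec} B$ at which the induced morphism $\operatorname{Spec} B \to \operatorname{Spec} A$ is étale is an open, $G$-invariant subset of $\operatorname{Spec} B$ that contains every closed point $[\mathfrak m]$ with $\mathfrak m \supseteq J$. -/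

import Mathlib

/-- The structure of an affine algebraic group over `k` on an abstract group `G`, given in the
classical way (`k` algebraically closed) through its algebra `k[G]` of regular functions: a finitely
generated algebra of `k`-valued functions on `G` such that the points of `G` are exactly the
`k`-algebra homomorphisms `k[G] → k` (that is, `G` is the affine variety with coordinate ring
`k[G]`), and such that multiplication `G × G → G` and inversion `G → G` are morphisms of
varieties. -/
structure AffineAlgebraicGroup (k G : Type*) [Field k] [Group G] where
  /-- The algebra `k[G]` of regular functions. -/
  regular : Subalgebra k (G → k)
  fg : regular.FG
  /-- Evaluation identifies `G` with the set of `k`-points of `k[G]`. -/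
  eval_bijective : Function.Bijective
    (fun g : G => ((Pi.evalAlgHom k (fun _ : G => k) g).comp regular.val : regular →ₐ[k] k))
  /-- Multiplication is a morphism: `(g, h) ↦ f (g * h)` lies in `k[G] ⊗ k[G] = k[G × G]`. -/
  mul_regular : ∀ f ∈ regular, ∃ (n : ℕ) (a b : Fin n → G → k),
    (∀ i, a i ∈ regular) ∧ (∀ i, b i ∈ regular) ∧
      ∀ g h : G, f (g * h) = ∑ i, a i g * b i h
  /-- Inversion is a morphism. -/
  inv_regular : ∀ f ∈ regular, (fun g : G => f g⁻¹) ∈ regular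

/-- A `k`-linear action of `G` on `M` is rational if every element of `M` lies in a
finite-dimensional `G`-stable subspace `V` on which `G` acts through a morphism of algebraic groups
`G → GL(V)`, i.e. with all matrix coefficients `g ↦ φ (g • v)` regular.  (Every linear form
on `V` is the restriction of one on `M`.) -/
def AffineAlgebraicGroup.IsRational {k G : Type*} [Field k] [Group G]
    (𝒢 : AffineAlgebraicGroup k G) (M : Type*) [AddCommGroup M] [Module k M]
    [DistribMulAction G M] [SMulCommClass G k M] : Prop :=
  ∀ m : M, ∃ V : Submodule k M, m ∈ V ∧ FiniteDimensional k V ∧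
    (∀ (g : G), ∀ v ∈ V, g • v ∈ V) ∧
    ∀ v ∈ V, ∀ φ : Module.Dual k M, (fun g : G => φ (g • v)) ∈ 𝒢.regular

/-- An ideal stable under the action of `G`. -/
def Ideal.IsInvariant (G : Type*) {R : Type*} [Group G] [CommRing R] [MulSemiringAction G R]
    (I : Ideal R) : Prop :=
  ∀ (g : G), ∀ x ∈ I, g • x ∈ I

/-- A subset of `Spec R` stable under the automorphisms of `Spec R` induced by the elements
of `G`. -/
def PrimeSpectrum.IsInvariant (G : Type*) {R : Type*} [Group G] [CommRing R]
    [MulSemiringAction G R] (U : Set (PrimeSpectrum R)) : Prop :=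
  ∀ g : G, PrimeSpectrum.comap (MulSemiringAction.toRingHom G R g) ⁻¹' U = U

/-- The set of the points of `Spec B` at which the morphism `Spec B → Spec A` induced by
`d : A → B` is étale. -/
def RingHom.etaleLocus {A B : Type*} [CommRing A] [CommRing B] (d : A →+* B) :
    Set (PrimeSpectrum B) :=
  letI : Algebra A B := d.toAlgebra
  Algebra.etaleLocus A B

/-! Let `m` be a maximal ideal containing `J`, with contraction `n`. The isomorphisms `A / I ^ r → B
/ J ^ r` force `A / n ^ r → B / m ^ r` to be bijective, so étaleness at `m` can be read off from
these quotients. Nakayama gives `n T = m T` in `T = B_m`, and the residue fields agree, so `d` is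
unramified at `m`; Artin–Rees and Krull's intersection theorem make `T` flat over `A`. Flat and
unramified together give étale. Openness is general, and invariance holds because étaleness is
transported along the automorphisms given by `G`. -/

/-! ### Flatness from adic approximation -/

open IsLocalRing in
/-- A Noetherian local `A`-algebra `T` whose reductions modulo the powers of its maximal ideal are
the quotients of `A` by the powers of an ideal `n` is flat over `A`. -/
theorem Module.Flat.of_quotient_maximalIdeal_pow {A T : Type*} [CommRing A] [CommRing T]
    [Algebra A T] [IsNoetherianRing A] [IsNoetherianRing T] [IsLocalRing T] (n : Ideal A)
    (hn : n ≤ (maximalIdeal T).comap (algebraMap A T))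
    (hsurj : ∀ (r : ℕ) (t : T), ∃ a : A, t - algebraMap A T a ∈ maximalIdeal T ^ r)
    (hinj : ∀ (r : ℕ) (a : A), algebraMap A T a ∈ maximalIdeal T ^ r → a ∈ n ^ r) :
    Module.Flat A T := by
  refine Module.Flat.of_forall_isTrivialRelation fun {l f x} hfx ↦ ?_
  let S : Set (Fin l → T) :=
    {z | ∃ y : Fin l → A, ∑ i, f i * y i = 0 ∧ z = fun i ↦ algebraMap A T (y i)}
  -- By the equational criterion, flatness amounts to `x ∈ W`: every relation over `T` is a
  -- combination of relations over `A`.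
  let W : Submodule T (Fin l → T) := Submodule.span T S
  have pi_mem : ∀ (r : ℕ) (v : Fin l → T), (∀ i, v i ∈ maximalIdeal T ^ r) →
      v ∈ (maximalIdeal T ^ r • ⊤ : Submodule T (Fin l → T)) := by
    intro r v hv
    rw [pi_eq_sum_univ v]
    exact Submodule.sum_mem _ fun i _ ↦ Submodule.smul_mem_smul (hv i) trivial
  -- The Artin–Rees constant: approximating `x` to order `r + c` leaves an error `∑ f i * b i` with
  -- `b i ∈ n ^ r`, and `a - b` is then an exact relation.
  obtain ⟨c, hc⟩ := Ideal.exists_pow_inf_eq_pow_smul n (Ideal.span (Set.range f))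
  have happrox : ∀ r : ℕ, ∃ w ∈ W,
      x - w ∈ (maximalIdeal T ^ r • ⊤ : Submodule T (Fin l → T)) := by
    intro r
    choose a ha using fun i ↦ hsurj (r + c) (x i)
    have h1 : ∑ i, f i * a i ∈ n ^ (r + c) := by
      apply hinj
      have : algebraMap A T (∑ i, f i * a i) =
          - ∑ i, algebraMap A T (f i) * (x i - algebraMap A T (a i)) := by
        simp only [mul_sub, Finset.sum_sub_distrib, map_sum, map_mul]
        simp only [Algebra.smul_def] at hfx
        rw [hfx]; ring
      rw [this]
      exact neg_mem (sum_mem fun i _ ↦ Ideal.mul_mem_left _ _ (ha i))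
    have h2 : ∑ i, f i * a i ∈ n ^ r • Submodule.span A (Set.range f) := by
      have h := hc (r + c) (Nat.le_add_left _ _)
      rw [Nat.add_sub_cancel] at h
      have h3 : ∑ i, f i * a i ∈ n ^ (r + c) • (⊤ : Ideal A) ⊓ Ideal.span (Set.range f) :=
        ⟨by simpa using h1,
          sum_mem fun i _ ↦ Ideal.mul_mem_right _ _ (Ideal.subset_span ⟨i, rfl⟩)⟩
      rw [h] at h3
      exact Submodule.smul_mono le_rfl inf_le_right h3
    obtain ⟨b, hb, hbs⟩ := (Submodule.mem_ideal_smul_span_iff_exists_sum _ _ _).mp h2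
    rw [Finsupp.sum_fintype _ _ (by simp)] at hbs
    refine ⟨_, Submodule.subset_span ⟨fun i ↦ a i - b i, ?_, rfl⟩, pi_mem r _ fun i ↦ ?_⟩
    · simp only [mul_sub, Finset.sum_sub_distrib, ← hbs, smul_eq_mul]
      simp only [mul_comm, sub_self]
    · have h3 := add_mem (Ideal.pow_le_pow_right (Nat.le_add_right r c) (ha i))
        (Ideal.pow_right_mono (Ideal.map_le_iff_le_comap.mpr hn) r
          (Ideal.map_pow (algebraMap A T) n r ▸ Ideal.mem_map_of_mem (algebraMap A T) (hb i)))
      simpa [sub_add] using h3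
  -- Krull's intersection theorem for `T ^ l / W`: `W` is closed in the adic topology.
  have hxW : x ∈ W := by
    rw [← Submodule.Quotient.mk_eq_zero, ← Submodule.mem_bot T,
      ← Ideal.iInf_pow_smul_eq_bot_of_le_jacobson (M := (Fin l → T) ⧸ W) (maximalIdeal T)
        (maximalIdeal_le_jacobson _), Submodule.mem_iInf]
    intro r
    obtain ⟨w, hw, hxw⟩ := happrox r
    have h := Submodule.mem_map_of_mem (f := W.mkQ) hxw
    rw [Submodule.map_smul''] at h
    rw [map_sub, Submodule.mkQ_apply, Submodule.mkQ_apply,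
      (Submodule.Quotient.mk_eq_zero W).mpr hw, sub_zero] at h
    exact Submodule.smul_mono le_rfl le_top h
  obtain ⟨k, t, z, hz⟩ := Submodule.mem_span_set'.mp hxW
  choose y hy hyz using fun j ↦ (z j).2
  refine ⟨k, fun i j ↦ y j i, t, fun i ↦ ?_, hy⟩
  rw [← hz, Finset.sum_apply]
  refine Finset.sum_congr rfl fun j _ ↦ ?_
  rw [Pi.smul_apply, hyz, smul_eq_mul, Algebra.smul_def, mul_comm]

/-! ### Powers of a maximal ideal under localization -/

open IsLocalRing in
/-- Reductions modulo powers of a maximal ideal are unchanged by localization: density. -/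
theorem Localization.AtPrime.exists_sub_algebraMap_mem_pow {A B : Type*} [CommRing A] [CommRing B]
    [Algebra A B] (m : Ideal B) [m.IsMaximal] (r : ℕ)
    (h : ∀ b : B, ∃ a : A, b - algebraMap A B a ∈ m ^ r) (t : Localization.AtPrime m) :
    ∃ a : A, t - algebraMap A (Localization.AtPrime m) a ∈
      maximalIdeal (Localization.AtPrime m) ^ r := by
  obtain ⟨b, s, rfl⟩ := IsLocalization.exists_mk'_eq m.primeCompl t
  have hcop : IsCoprime (Ideal.span {(s : B)}) (m ^ r) := by
    refine IsCoprime.pow_right ?_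
    obtain ⟨y, i, hi, hy⟩ := Ideal.IsMaximal.exists_inv ‹m.IsMaximal› s.2
    exact Ideal.isCoprime_iff_exists.mpr
      ⟨y * s, Ideal.mul_mem_left _ _ (Ideal.mem_span_singleton_self _), i, hi, hy⟩
  obtain ⟨_, hu, i, hi, hui⟩ := Ideal.isCoprime_iff_exists.mp hcop
  obtain ⟨u, rfl⟩ := Ideal.mem_span_singleton.mp hu
  -- `s * u` is an inverse pair modulo `m ^ r`, so `b * u` stands in for `b / s`.
  obtain ⟨a, ha⟩ := h (b * u)
  refine ⟨a, ?_⟩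
  rw [← Localization.AtPrime.map_eq_maximalIdeal, ← Ideal.map_pow]
  have hs := IsLocalization.map_units (Localization.AtPrime m) s
  rw [← Ideal.unit_mul_mem_iff_mem _ hs, mul_sub, IsLocalization.mk'_spec',
    IsScalarTower.algebraMap_apply A B, ← map_mul, ← map_sub]
  refine Ideal.mem_map_of_mem _ ?_
  have : b - s * algebraMap A B a = b * i + s * (b * u - algebraMap A B a) := by
    linear_combination (-b) * hui
  rw [this]
  exact add_mem (Ideal.mul_mem_left _ _ hi) (Ideal.mul_mem_left _ _ ha)

-- Elements outside `m` are already units modulo `m ^ r`, so denominators can be cleared there.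
open IsLocalRing in
theorem Localization.AtPrime.algebraMap_mem_maximalIdeal_pow_iff {B : Type*} [CommRing B]
    (m : Ideal B) [m.IsMaximal] (r : ℕ) (b : B) :
    algebraMap B (Localization.AtPrime m) b ∈ maximalIdeal (Localization.AtPrime m) ^ r ↔
      b ∈ m ^ r := by
  rw [← Localization.AtPrime.map_eq_maximalIdeal, ← Ideal.map_pow]
  refine ⟨fun h ↦ ?_, fun h ↦ Ideal.mem_map_of_mem _ h⟩
  obtain ⟨s, hs, h⟩ := (IsLocalization.algebraMap_mem_map_algebraMap_iff m.primeCompl _ _ _).mp h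
  obtain ⟨_, hu, i, hi, hui⟩ := Ideal.isCoprime_iff_exists.mp
    (IsCoprime.pow_right (n := r) (Ideal.isCoprime_iff_exists.mpr (by
      obtain ⟨y, i, hi, hy⟩ := Ideal.IsMaximal.exists_inv ‹m.IsMaximal› hs
      exact ⟨y * s, Ideal.mul_mem_left _ _ (Ideal.mem_span_singleton_self _), i, hi, hy⟩) :
      IsCoprime (Ideal.span {s}) m))
  obtain ⟨u, rfl⟩ := Ideal.mem_span_singleton.mp hu
  rw [← one_mul b, ← hui, add_mul]
  exact add_mem (by simpa [mul_assoc, mul_left_comm] using Ideal.mul_mem_left _ u h)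
    (Ideal.mul_mem_right _ _ hi)

/-! ### Étaleness at a maximal ideal -/

open IsLocalRing TensorProduct in
/-- If `S` is a finitely presented `R`-algebra that is unramified at a prime `q` and whose local
ring at `q` is flat over `R`, then `S` is étale over `R` at `q`. -/
theorem Algebra.IsEtaleAt.of_isUnramifiedAt_of_flat_localization {R S : Type*} [CommRing R]
    [CommRing S] [Algebra R S] [Algebra.FinitePresentation R S] (q : Ideal S) [q.IsPrime]
    [Algebra.IsUnramifiedAt R q] [Module.Flat R (Localization.AtPrime q)] :
    Algebra.IsEtaleAt R q := by
  let p : Ideal R := q.under R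
  let Rp := Localization.AtPrime p
  let Sp := Localization (algebraMapSubmonoid S p.primeCompl)
  let Sq := Localization.AtPrime q
  let := Localization.AtPrime.algebraOfLiesOver p q
  let f : Sp →ₐ[S] Sq := IsLocalization.liftAlgHom (M := algebraMapSubmonoid S p.primeCompl)
        (f := Algebra.ofId _ _) (by
      rintro ⟨_, x, hx, rfl⟩
      simpa using! IsLocalization.map_units (M := q.primeCompl) Sq ⟨algebraMap _ _ x,
        by simp_all [q.over_def p]⟩)
  algebraize [f.toRingHom]
  have : IsScalarTower R Sp Sq := .to₁₃₄ _ S _ _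
  have : IsScalarTower Rp Sp Sq := .of_algebraMap_eq' <| by
    apply IsLocalization.ringHom_ext p.primeCompl
    simp only [RingHom.comp_assoc, ← IsScalarTower.algebraMap_eq]
  have : IsLocalization (algebraMapSubmonoid Sp q.primeCompl) Sq :=
    .isLocalization_of_submonoid_le _ _ (algebraMapSubmonoid S p.primeCompl) _
    (by rintro _ ⟨x, hx, rfl⟩; simp_all [q.over_def p])
  have : FinitePresentation Rp Sp := by
    have : Algebra.IsPushout R Rp S Sp :=
      .symm <| Algebra.isPushout_of_isLocalization p.primeCompl _ _ _
    exact .equiv (Algebra.IsPushout.equiv R Rp S Sp)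
  have : Module.Flat Rp Sq := (Module.flat_iff_of_isLocalization Rp p.primeCompl Sq).mpr inferInstance
  have : FormallyUnramified Rp Sq := .of_restrictScalars R _ _
  have : EssFiniteType Rp Sq := .of_comp R _ _
  -- Over a field unramified implies étale; flatness then lifts smoothness from the fibre.
  have : FormallyEtale (ResidueField Rp) (ResidueField Rp ⊗[Rp] Sq) :=
    .of_formallyUnramified_of_field _ _
  have := FormallySmooth.of_formallySmooth_residueField_tensor
    (R := Rp) (S := Sq) (P := Sp) (algebraMapSubmonoid _ q.primeCompl)
  have : FormallySmooth R Sq := .comp R Rp Sq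
  exact FormallyEtale.iff_formallyUnramified_and_formallySmooth.mpr ⟨inferInstance, inferInstance⟩

open IsLocalRing in
/-- Let `B` be a finitely generated algebra over a Noetherian ring `A`, let `m` be a maximal ideal
of `B` and let `n` be its contraction to `A`. If the maps `A / n ^ r → B / m ^ r` are bijective
then `B` is étale over `A` at `m`. -/
theorem Algebra.IsEtaleAt.of_quotient_pow {A B : Type*} [CommRing A] [CommRing B] [Algebra A B]
    [IsNoetherianRing A] [Algebra.FiniteType A B] (m : Ideal B) [m.IsMaximal]
    (hsurj : ∀ (r : ℕ) (b : B), ∃ a : A, b - algebraMap A B a ∈ m ^ r)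
    (hinj : ∀ (r : ℕ) (a : A), algebraMap A B a ∈ m ^ r → a ∈ m.under A ^ r) :
    Algebra.IsEtaleAt A m := by
  have : IsNoetherianRing B := Algebra.FiniteType.isNoetherianRing A B
  have : Algebra.FinitePresentation A B :=
    Algebra.FinitePresentation.of_finiteType.mp inferInstance
  let T := Localization.AtPrime m
  have hsurj' (r : ℕ) (t : T) : ∃ a : A, t - algebraMap A T a ∈ maximalIdeal T ^ r :=
    Localization.AtPrime.exists_sub_algebraMap_mem_pow m r (hsurj r) t
  have hinj' (r : ℕ) (a : A) (h : algebraMap A T a ∈ maximalIdeal T ^ r) : a ∈ m.under A ^ r := by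
    rw [IsScalarTower.algebraMap_apply A B T,
      Localization.AtPrime.algebraMap_mem_maximalIdeal_pow_iff] at h
    exact hinj r a h
  have hle : m.under A ≤ (maximalIdeal T).comap (algebraMap A T) := fun a ha ↦ by
    have := (Localization.AtPrime.algebraMap_mem_maximalIdeal_pow_iff m 1 (algebraMap A B a)).mpr
      (by simpa using ha)
    rwa [pow_one, ← IsScalarTower.algebraMap_apply] at this
  have : Module.Flat A T := .of_quotient_maximalIdeal_pow (m.under A) hle hsurj' hinj'
  let := Localization.AtPrime.algebraOfLiesOver (m.under A) m
  have : Algebra.IsUnramifiedAt A m := by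
    rw [Algebra.isUnramifiedAt_iff_map_eq A (m.under A) m]
    constructor
    · have hres : Function.Surjective
          (algebraMap (m.under A).ResidueField m.ResidueField) := by
        intro y
        obtain ⟨t, rfl⟩ := residue_surjective y
        obtain ⟨a, ha⟩ := hsurj' 1 t
        refine ⟨algebraMap A _ a, ?_⟩
        rw [← IsScalarTower.algebraMap_apply A, IsScalarTower.algebraMap_apply A T m.ResidueField,
          eq_comm, ← sub_eq_zero]
        change residue T t - residue T _ = 0
        rw [← map_sub, residue_eq_zero_iff]
        simpa using ha
      exact ⟨fun y ↦ by
        obtain ⟨a, rfl⟩ := hres y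
        exact isSeparable_algebraMap a⟩
    · refine le_antisymm (Ideal.map_le_iff_le_comap.mpr hle) ?_
      -- Nakayama: approximation to order 2 shows that `n` generates the maximal ideal modulo its
      -- square.
      refine Submodule.le_of_le_smul_of_le_jacobson_bot (I := maximalIdeal T)
        (IsNoetherian.noetherian _) (maximalIdeal_le_jacobson _) fun t ht ↦ ?_
      obtain ⟨a, ha⟩ := hsurj' 2 t
      have hat : algebraMap A T a ∈ maximalIdeal T ^ 1 := by
        have := sub_mem ht (Ideal.pow_le_self two_ne_zero ha)
        simpa using this
      refine Submodule.mem_sup.mpr ⟨_, Ideal.mem_map_of_mem _ (by simpa using hinj' 1 a hat), _,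
        ?_, add_sub_cancel (algebraMap A T a) t⟩
      simpa [pow_two] using ha
  exact .of_isUnramifiedAt_of_flat_localization m

/-- If `A / I ^ n → B / J ^ n` is bijective for all `n` then `A → B` is étale at every maximal
ideal of `B` that contains `J`. -/
theorem Algebra.IsEtaleAt.of_bijective_quotientMap_pow {A B : Type*} [CommRing A] [CommRing B]
    [Algebra A B] [IsNoetherianRing A] [Algebra.FiniteType A B] (I : Ideal A) (J : Ideal B)
    (hIJ : ∀ n : ℕ, ∃ h : I ^ n ≤ (J ^ n).comap (algebraMap A B),
      Function.Bijective (Ideal.quotientMap (J ^ n) (algebraMap A B) h))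
    (m : Ideal B) [m.IsMaximal] (hJm : J ≤ m) :
    Algebra.IsEtaleAt A m := by
  have hIm : I ≤ m.under A := by
    obtain ⟨h, -⟩ := hIJ 1
    rw [pow_one, pow_one] at h
    exact h.trans (Ideal.comap_mono hJm)
  have hsurj (r : ℕ) (b : B) : ∃ a : A, b - algebraMap A B a ∈ J ^ r := by
    obtain ⟨h, -, hs⟩ := hIJ r
    obtain ⟨a, ha⟩ := hs (Ideal.Quotient.mk _ b)
    obtain ⟨a, rfl⟩ := Ideal.Quotient.mk_surjective a
    rw [Ideal.quotientMap_mk, eq_comm, Ideal.Quotient.mk_eq_mk_iff_sub_mem] at ha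
    exact ⟨a, ha⟩
  have hinj (r : ℕ) (a : A) (ha : algebraMap A B a ∈ J ^ r) : a ∈ I ^ r := by
    obtain ⟨h, hi, -⟩ := hIJ r
    rw [← Ideal.Quotient.eq_zero_iff_mem]
    apply hi
    rwa [Ideal.quotientMap_mk, map_zero, Ideal.Quotient.eq_zero_iff_mem]
  refine .of_quotient_pow m (fun r b ↦ ?_) fun r a ha ↦ ?_
  · obtain ⟨a, ha⟩ := hsurj r b
    exact ⟨a, Ideal.pow_right_mono hJm r ha⟩
  · rcases Nat.eq_zero_or_pos r with rfl | hr
    · simp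
    let φ : A →+* B ⧸ J ^ r := (Ideal.Quotient.mk (J ^ r)).comp (algebraMap A B)
    have hφ : Function.Surjective φ := fun y ↦ by
      obtain ⟨b, rfl⟩ := Ideal.Quotient.mk_surjective y
      obtain ⟨a, ha⟩ := hsurj r b
      exact ⟨a, ((Ideal.Quotient.mk_eq_mk_iff_sub_mem _ _).mpr ha).symm⟩
    -- Approximants modulo `J ^ r` of elements of `m` lie in `n`, since `J ^ r ≤ m` for `r > 0`.
    have hle : m.map (Ideal.Quotient.mk (J ^ r)) ≤ (m.under A).map φ := by
      refine Ideal.map_le_iff_le_comap.mpr fun b hb ↦ ?_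
      obtain ⟨a, ha⟩ := hsurj r b
      have ham : a ∈ m.under A := by
        have := sub_mem hb (hJm (Ideal.pow_le_self hr.ne' ha))
        simpa using this
      rw [Ideal.mem_comap, (Ideal.Quotient.mk_eq_mk_iff_sub_mem _ _).mpr ha]
      exact Ideal.mem_map_of_mem φ ham
    have hmem : φ a ∈ (m.under A ^ r).map φ := by
      rw [Ideal.map_pow]
      refine Ideal.pow_right_mono hle r ?_
      rw [← Ideal.map_pow]
      exact Ideal.mem_map_of_mem _ ha
    obtain ⟨a', ha', h⟩ := (Ideal.mem_map_iff_of_surjective φ hφ).mp hmem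
    have := hinj r (a - a') (by
      rw [map_sub]; exact (Ideal.Quotient.mk_eq_mk_iff_sub_mem _ _).mp h.symm)
    simpa using add_mem (Ideal.pow_right_mono hIm r this) ha'

/-! ### Transport along automorphisms -/

theorem RingHom.FormallyEtale.of_bijective {R S : Type*} [CommRing R] [CommRing S] {f : R →+* S}
    (hf : Function.Bijective f) : f.FormallyEtale := by
  let := f.toAlgebra
  exact Algebra.FormallyEtale.of_equiv (A := R)
    (AlgEquiv.ofBijective (Algebra.ofId R S) hf)

/-- Phrased through ring homomorphisms so that isomorphisms can be composed on either side. -/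
theorem RingHom.mem_etaleLocus_iff {A B : Type*} [CommRing A] [CommRing B] (d : A →+* B)
    (x : PrimeSpectrum B) : x ∈ d.etaleLocus ↔
      ((algebraMap B (Localization.AtPrime x.asIdeal)).comp d).FormallyEtale := by
  let := d.toAlgebra
  rw [← RingHom.algebraMap_toAlgebra d, ← IsScalarTower.algebraMap_eq,
    RingHom.formallyEtale_algebraMap]
  rfl

/-- The étale locus is transported by automorphisms of source and target. -/
theorem RingHom.mem_etaleLocus_of_comap_mem {A B : Type*} [CommRing A] [CommRing B] (d : A →+* B)
    (σ : A ≃+* A) (τ : B ≃+* B) (h : ∀ a, d (σ a) = τ (d a)) (x : PrimeSpectrum B)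
    (hx : PrimeSpectrum.comap (τ : B →+* B) x ∈ d.etaleLocus) : x ∈ d.etaleLocus := by
  rw [RingHom.mem_etaleLocus_iff] at hx ⊢
  let e := Localization.localRingEquiv (PrimeSpectrum.comap (τ : B →+* B) x).asIdeal
    x.asIdeal τ rfl
  have key : (algebraMap B (Localization.AtPrime x.asIdeal)).comp d =
      ((e : _ →+* Localization.AtPrime x.asIdeal).comp
        ((algebraMap B (Localization.AtPrime
          (PrimeSpectrum.comap (τ : B →+* B) x).asIdeal)).comp d)).comp
        (σ.symm : A →+* A) := by
    ext a
    obtain ⟨a, rfl⟩ := σ.surjective a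
    simp only [RingHom.comp_apply, RingHom.coe_coe, RingEquiv.symm_apply_apply, h]
    exact (Localization.localRingHom_to_map
      (PrimeSpectrum.comap (τ : B →+* B) x).asIdeal x.asIdeal (τ : B →+* B) rfl (d a)).symm
  rw [key]
  exact ((FormallyEtale.of_bijective σ.symm.bijective).comp hx).comp
    (FormallyEtale.of_bijective e.bijective)

theorem proposition3 {k G A B : Type*} [Field k] [IsAlgClosed k]
    [Group G] (𝒢 : AffineAlgebraicGroup k G)
    [CommRing A] [Algebra k A] [Algebra.FiniteType k A]
    [CommRing B] [Algebra k B] [Algebra.FiniteType k B]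
    [MulSemiringAction G A] [SMulCommClass G k A] (hA : 𝒢.IsRational A)
    [MulSemiringAction G B] [SMulCommClass G k B] (hB : 𝒢.IsRational B)
    (I : Ideal A) (hI : I.IsInvariant G) (J : Ideal B) (hJ : J.IsInvariant G)
    (d : A →ₐ[k] B) (hd : ∀ (g : G) (a : A), d (g • a) = g • d a)
    (hIJ : ∀ n : ℕ, ∃ h : I ^ n ≤ (J ^ n).comap (d : A →+* B),
      Function.Bijective (Ideal.quotientMap (J ^ n) (d : A →+* B) h)) :
    IsOpen (d : A →+* B).etaleLocus ∧
      PrimeSpectrum.IsInvariant G (d : A →+* B).etaleLocus ∧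
      ∀ x : PrimeSpectrum B, IsClosed ({x} : Set (PrimeSpectrum B)) → J ≤ x.asIdeal →
        x ∈ (d : A →+* B).etaleLocus := by
  have : IsNoetherianRing A := Algebra.FiniteType.isNoetherianRing k A
  let := (d : A →+* B).toAlgebra
  have : IsScalarTower k A B := .of_algebraMap_eq fun r ↦ (d.commutes r).symm
  have : Algebra.FiniteType A B := .of_restrictScalars_finiteType k A B
  have : Algebra.FinitePresentation A B :=
    Algebra.FinitePresentation.of_finiteType.mp inferInstance
  refine ⟨Algebra.isOpen_etaleLocus (R := A) (A := B), fun g ↦ ?_, fun x hx hJx ↦ ?_⟩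
  · have hmem (g : G) (x : PrimeSpectrum B)
        (hx : PrimeSpectrum.comap (MulSemiringAction.toRingHom G B g) x ∈
          (d : A →+* B).etaleLocus) : x ∈ (d : A →+* B).etaleLocus :=
      (d : A →+* B).mem_etaleLocus_of_comap_mem (MulSemiringAction.toRingEquiv G A g)
        (MulSemiringAction.toRingEquiv G B g) (hd g) x hx
    -- The reverse inclusion is the same statement for `g⁻¹`.
    refine Set.Subset.antisymm (fun x hx ↦ hmem g x hx) fun x hx ↦ hmem g⁻¹ _ ?_
    convert hx
    ext b
    simp
  · have := (PrimeSpectrum.isClosed_singleton_iff_isMaximal x).mp hx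
    exact Algebra.IsEtaleAt.of_bijective_quotientMap_pow I J hIJ x.asIdeal hJx
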